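/- Let $n\ge 2$, let $X=\{1,\dots,n\}$, and let $X'=\{x' : x\in X\}$ be a disjoint copy of $X$. A block of a partition of $X\cup X'$ is called a \emph{point} if it has exactly one element, and a \emph{generalised line} if it meets both $X$ and $X'$. Let $\mathcal{PI}^*_n$ be the set of all partitions of $X\cup X'$ whose blocks are points or generalised lines, with the following associative multiplication. Let $\overline{x}\notin X$. For $\alpha\in\mathcal{PI}^*_n$ let $\overline{\alpha}$ be the partition of $(X\cup\{\overline{x}\})\cup(X\cup\{\overline{x}\})'$ whose blocks are the generalised lines of $\alpha$ and one further block consisting of $\overline{x}$, $\overline{x}'$ and all points of $\alpha$. The product $\overline{\alpha}\,\overline{\beta}$ of two such partitions is the natural product of partitions: put $\overline\alpha$ above $\overline\beta$, identify each bottom (primed) vertex of $\overline\alpha$ with the corresponding top (unprimed) vertex of $\overline\beta$, and restrict the resulting connected components to the top vertices of $\overline\alpha$ and the bottom vertices of $\overline\beta$. Then $\alpha\star\beta$ is the unique element of $\mathcal{PI}^*_n$ with $\overline{\alpha\star\beta}=\overline{\alpha}\,\overline{\beta}$. Let $\mathcal{S}_n\subset\mathcal{PI}^*_n$ be the symmetric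 group, i.e. the set of partitions $\{\{x,\pi(x)'\} : x\in X\}$ for permutations $\pi$ of $X$. A nonempty subsemigroup $T$ of a semigroup $S$ is called \emph{completely isolated} if for all $a,b\in S$, $ab\in T$ implies $a\in T$ or $b\in T$. Then $\mathcal{PI}^*_n$, $\mathcal{S}_n$ and $\mathcal{PI}^*_n\setminus\mathcal{S}_n$ are completely isolated subsemigroups of $\mathcal{PI}^*_n$, and they are the only completely isolated subsemigroups of $\mathcal{PI}^*_n$. -/

import Mathlib

/-- A one-element subset of `X ∪ X'`. The disjoint union `X ∪ X'` is modelled by `X ⊕ X`: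
`inl x` is the (top) vertex `x`, `inr x` is the (bottom) vertex `x'`. -/
def IsPoint {X : Type*} (A : Set (X ⊕ X)) : Prop :=
  ∃ p, A = {p}

/-- A subset of `X ∪ X'` that intersects both `X` and `X'`. -/
def IsGeneralisedLine {X : Type*} (A : Set (X ⊕ X)) : Prop :=
  (∃ x, Sum.inl x ∈ A) ∧ (∃ y, Sum.inr y ∈ A)

/-- The top and middle layers of three layers of vertices. -/
def upper {X : Type*} : X ⊕ X → X ⊕ (X ⊕ X) := Sum.map id Sum.inl

/-- The middle and bottom layers of three layers of vertices. -/
def lower {X : Type*} : X ⊕ X → X ⊕ (X ⊕ X) := Sum.inr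

/-- The top and bottom layers of three layers of vertices. -/
def outer {X : Type*} : X ⊕ X → X ⊕ (X ⊕ X) := Sum.map id Sum.inr

/-- The natural multiplication of partitions of `X ∪ X'` (given as equivalence relations):
put `α` above `β`, identify the bottom vertices of `α` with the top vertices of `β`, take the
connected components, and restrict them to the top vertices of `α` and the bottom vertices
of `β`. -/
def naturalMul {X : Type*} (α β : Setoid (X ⊕ X)) : Setoid (X ⊕ X) :=
  Setoid.comap outer (Setoid.map α upper ⊔ Setoid.map β lower)

/-- The carrier of `PI*_X`: the partitions of `X ∪ X'` all of whose blocks are points or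
generalised lines. -/
@[ext] structure PIStar (X : Type*) where
  rel : Setoid (X ⊕ X)
  point_or_line : ∀ A ∈ rel.classes, IsPoint A ∨ IsGeneralisedLine A

namespace PIStar

variable {X : Type*}

/-- The inclusion of `X ∪ X'` into `(X ∪ {x̄}) ∪ (X ∪ {x̄})'`, where `x̄` is `none`. -/
def incl : X ⊕ X → Option X ⊕ Option X := Sum.map some some

theorem incl_injective : Function.Injective (incl (X := X)) :=
  Sum.map_injective.2 ⟨Option.some_injective X, Option.some_injective X⟩

/-- The additional block of `ᾱ`: it consists of `x̄`, `x̄'` and all points of `α`. -/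
def extraBlock (α : PIStar X) : Set (Option X ⊕ Option X) :=
  {Sum.inl none, Sum.inr none} ∪ {u | ∃ p, u = incl p ∧ {p} ∈ α.rel.classes}

theorem singleton_mem_classes_iff (r : Setoid (X ⊕ X)) (p : X ⊕ X) :
    {p} ∈ r.classes ↔ ∀ q, r q p → q = p := by
  constructor
  · rintro ⟨y, hy⟩ q hq
    have hp : p ∈ ({p} : Set (X ⊕ X)) := rfl
    rw [hy] at hp
    have : q ∈ ({p} : Set (X ⊕ X)) := by
      rw [hy]; exact r.trans' hq hp
    exact this
  · intro h
    refine ⟨p, ?_⟩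
    ext q
    constructor
    · rintro rfl; exact r.refl' _
    · exact fun hq => h q hq

theorem incl_mem_extraBlock_iff (α : PIStar X) (p : X ⊕ X) :
    incl p ∈ α.extraBlock ↔ ∀ q, α.rel q p → q = p := by
  rw [← singleton_mem_classes_iff]
  constructor
  · rintro (h | ⟨q, hq, hc⟩)
    · rcases p with p | p <;> rcases h with h | h <;> cases h
    · rwa [incl_injective hq]
  · exact fun h => Or.inr ⟨p, rfl, h⟩

theorem extraBlock_eq_of_rel (α : PIStar X) {p q : X ⊕ X} (h : α.rel p q)
    (hp : incl p ∈ α.extraBlock) : q = p :=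
  (incl_mem_extraBlock_iff α p).1 hp q (α.rel.symm' h)

/-- The partition `ᾱ` of `(X ∪ {x̄}) ∪ (X ∪ {x̄})'`: its blocks are the generalised lines of `α`
and the block consisting of `x̄`, `x̄'` and all points of `α`. -/
def bar (α : PIStar X) : Setoid (Option X ⊕ Option X) where
  r u v := (u ∈ α.extraBlock ∧ v ∈ α.extraBlock) ∨
    ∃ p q, u = incl p ∧ v = incl q ∧ α.rel p q
  iseqv :=
    { refl := by
        rintro ((_ | x) | (_ | x))
        · exact Or.inl ⟨Or.inl (Or.inl rfl), Or.inl (Or.inl rfl)⟩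
        · exact Or.inr ⟨Sum.inl x, Sum.inl x, rfl, rfl, α.rel.refl' _⟩
        · exact Or.inl ⟨Or.inl (Or.inr rfl), Or.inl (Or.inr rfl)⟩
        · exact Or.inr ⟨Sum.inr x, Sum.inr x, rfl, rfl, α.rel.refl' _⟩
      symm := by
        rintro u v (⟨hu, hv⟩ | ⟨p, q, hu, hv, h⟩)
        · exact Or.inl ⟨hv, hu⟩
        · exact Or.inr ⟨q, p, hv, hu, α.rel.symm' h⟩
      trans := by
        rintro u v w (⟨hu, hv⟩ | ⟨p, q, rfl, rfl, h⟩) (⟨hv', hw⟩ | ⟨p', q', hv', hw, h'⟩)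
        · exact Or.inl ⟨hu, hw⟩
        · subst hv' hw
          rw [extraBlock_eq_of_rel α h' hv]
          exact Or.inl ⟨hu, hv⟩
        · rw [← extraBlock_eq_of_rel α (α.rel.symm' h) hv'] at hv'
          exact Or.inl ⟨hv', hw⟩
        · subst hw
          rw [← incl_injective hv'] at h'
          exact Or.inr ⟨p, q', rfl, rfl, α.rel.trans' h h'⟩ }

/-- All blocks of `ᾱ` are generalised lines. -/
theorem bar_isGeneralisedLine (α : PIStar X) :
    ∀ A ∈ α.bar.classes, IsGeneralisedLine A := by
  rintro A ⟨u, rfl⟩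
  by_cases hu : u ∈ α.extraBlock
  · exact ⟨⟨none, Or.inl ⟨Or.inl (Or.inl rfl), hu⟩⟩, ⟨none, Or.inl ⟨Or.inl (Or.inr rfl), hu⟩⟩⟩
  · obtain ⟨p, rfl⟩ : ∃ p, u = incl p := by
      rcases u with (_ | x) | (_ | x)
      · exact absurd (Or.inl (Or.inl rfl)) hu
      · exact ⟨Sum.inl x, rfl⟩
      · exact absurd (Or.inl (Or.inr rfl)) hu
      · exact ⟨Sum.inr x, rfl⟩
    rcases α.point_or_line _ ⟨p, rfl⟩ with ⟨q, hq⟩ | ⟨⟨x, hx⟩, ⟨y, hy⟩⟩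
    · have hp : p ∈ ({q} : Set (X ⊕ X)) := by rw [← hq]; exact α.rel.refl' p
      cases hp
      exact absurd (Or.inr ⟨p, rfl, ⟨p, hq.symm⟩⟩) hu
    · exact ⟨⟨some x, Or.inr ⟨_, _, rfl, rfl, hx⟩⟩, ⟨some y, Or.inr ⟨_, _, rfl, rfl, hy⟩⟩⟩

theorem naturalMul_isGeneralisedLine {Y : Type*} {r s : Setoid (Y ⊕ Y)}
    (hr : ∀ A ∈ r.classes, IsGeneralisedLine A) (hs : ∀ A ∈ s.classes, IsGeneralisedLine A) :
    ∀ A ∈ (naturalMul r s).classes, IsGeneralisedLine A := by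
  have h1 : r ≤ Setoid.comap upper (Setoid.map r upper ⊔ Setoid.map s lower) := fun a b h =>
    (le_sup_left : Setoid.map r upper ≤ Setoid.map r upper ⊔ Setoid.map s lower)
      (Relation.EqvGen.rel _ _ ⟨a, b, h, rfl, rfl⟩)
  have h2 : s ≤ Setoid.comap lower (Setoid.map r upper ⊔ Setoid.map s lower) := fun a b h =>
    (le_sup_right : Setoid.map s lower ≤ Setoid.map r upper ⊔ Setoid.map s lower)
      (Relation.EqvGen.rel _ _ ⟨a, b, h, rfl, rfl⟩)
  rintro A ⟨(x | y), rfl⟩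
  · refine ⟨⟨x, (naturalMul r s).refl' _⟩, ?_⟩
    obtain ⟨m, hm⟩ := (hr _ ⟨Sum.inl x, rfl⟩).2
    obtain ⟨z, hz⟩ := (hs _ ⟨Sum.inl m, rfl⟩).2
    exact ⟨z, (Setoid.map r upper ⊔ Setoid.map s lower).trans' (h2 hz) (h1 hm)⟩
  · refine ⟨?_, ⟨y, (naturalMul r s).refl' _⟩⟩
    obtain ⟨m, hm⟩ := (hs _ ⟨Sum.inr y, rfl⟩).1
    obtain ⟨z, hz⟩ := (hr _ ⟨Sum.inr m, rfl⟩).1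
    exact ⟨z, (Setoid.map r upper ⊔ Setoid.map s lower).trans' (h1 hz) (h2 hm)⟩

/-- The inverse of `α ↦ ᾱ`, on partitions `γ` of `(X ∪ {x̄}) ∪ (X ∪ {x̄})'` into generalised lines
with `x̄` and `x̄'` in one block: the blocks that do not contain `x̄` are kept and
every other vertex of `X ∪ X'` becomes a point. -/
def unbar (γ : Setoid (Option X ⊕ Option X)) (hγ : ∀ A ∈ γ.classes, IsGeneralisedLine A)
    (h0 : γ (Sum.inl none) (Sum.inr none)) : PIStar X where
  rel :=
    { r := fun p q => p = q ∨ (γ (incl p) (incl q) ∧ ¬ γ (incl p) (Sum.inl none))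
      iseqv :=
        { refl := fun _ => Or.inl rfl
          symm := by
            rintro p q (rfl | ⟨h, hn⟩)
            · exact Or.inl rfl
            · exact Or.inr ⟨γ.symm' h, fun h' => hn (γ.trans' h h')⟩
          trans := by
            rintro p q s (rfl | ⟨h, hn⟩) (rfl | ⟨h', hn'⟩)
            · exact Or.inl rfl
            · exact Or.inr ⟨h', hn'⟩
            · exact Or.inr ⟨h, hn⟩
            · exact Or.inr ⟨γ.trans' h h', hn⟩ } }
  point_or_line := by
    rintro A ⟨p, rfl⟩
    by_cases hp : γ (incl p) (Sum.inl none)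
    · left
      refine ⟨p, ?_⟩
      ext q
      constructor
      · rintro (h | ⟨h, hn⟩)
        · exact h
        · exact absurd (γ.trans' h hp) hn
      · exact fun h => Or.inl h
    · right
      obtain ⟨⟨x, hx⟩, ⟨y, hy⟩⟩ := hγ _ ⟨incl p, rfl⟩
      constructor
      · rcases x with _ | x
        · exact absurd (γ.symm' hx) hp
        · exact ⟨x, Or.inr ⟨hx, fun h => hp (γ.trans' (γ.symm' hx) h)⟩⟩
      · rcases y with _ | y
        · exact absurd (γ.symm' (γ.trans' h0 hy)) hp
        · exact ⟨y, Or.inr ⟨hy, fun h => hp (γ.trans' (γ.symm' hy) h)⟩⟩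

theorem bar_none (α : PIStar X) : α.bar (Sum.inl none) (Sum.inr none) :=
  Or.inl ⟨Or.inl (Or.inl rfl), Or.inl (Or.inr rfl)⟩

theorem naturalMul_none {r s : Setoid (Option X ⊕ Option X)}
    (hr : r (Sum.inl none) (Sum.inr none)) (hs : s (Sum.inl none) (Sum.inr none)) :
    naturalMul r s (Sum.inl none) (Sum.inr none) := by
  have h1 : (Setoid.map r upper ⊔ Setoid.map s lower) (upper (Sum.inl none))
      (upper (Sum.inr none)) :=
    (le_sup_left : Setoid.map r upper ≤ Setoid.map r upper ⊔ Setoid.map s lower)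
      (Relation.EqvGen.rel _ _ ⟨_, _, hr, rfl, rfl⟩)
  have h2 : (Setoid.map r upper ⊔ Setoid.map s lower) (lower (Sum.inl none))
      (lower (Sum.inr none)) :=
    (le_sup_right : Setoid.map s lower ≤ Setoid.map r upper ⊔ Setoid.map s lower)
      (Relation.EqvGen.rel _ _ ⟨_, _, hs, rfl, rfl⟩)
  exact (Setoid.map r upper ⊔ Setoid.map s lower).trans' h1 h2

/-- `α ⋆ β` is the element of `PI*_X` whose image under `α ↦ ᾱ` is the natural product
of `ᾱ` and `β̄`. -/
instance : Mul (PIStar X) where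
  mul α β := unbar (naturalMul α.bar β.bar)
    (naturalMul_isGeneralisedLine α.bar_isGeneralisedLine β.bar_isGeneralisedLine)
    (naturalMul_none α.bar_none β.bar_none)

theorem bar_unbar (γ : Setoid (Option X ⊕ Option X)) (hγ : ∀ A ∈ γ.classes, IsGeneralisedLine A)
    (h0 : γ (Sum.inl none) (Sum.inr none)) : (unbar γ hγ h0).bar = γ := by
  have key : ∀ u, u ∈ (unbar γ hγ h0).extraBlock ↔ γ u (Sum.inl none) := by
    have hincl : ∀ p, incl p ∈ (unbar γ hγ h0).extraBlock ↔ γ (incl p) (Sum.inl none) := by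
      intro p
      rw [incl_mem_extraBlock_iff]
      constructor
      · intro h
        by_contra hp
        obtain ⟨⟨x, hx⟩, ⟨y, hy⟩⟩ := hγ _ ⟨incl p, rfl⟩
        rcases x with _ | x
        · exact hp (γ.symm' hx)
        rcases y with _ | y
        · exact hp (γ.symm' (γ.trans' h0 hy))
        have e1 := h (Sum.inl x) (Or.inr ⟨hx, fun h => hp (γ.trans' (γ.symm' hx) h)⟩)
        have e2 := h (Sum.inr y) (Or.inr ⟨hy, fun h => hp (γ.trans' (γ.symm' hy) h)⟩)
        cases e1.trans e2.symm
      · rintro h q (h' | ⟨h', hn⟩)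
        · exact h'
        · exact absurd (γ.trans' h' h) hn
    rintro ((_ | x) | (_ | x))
    · exact ⟨fun _ => γ.refl' _, fun _ => Or.inl (Or.inl rfl)⟩
    · exact hincl (Sum.inl x)
    · exact ⟨fun _ => γ.symm' h0, fun _ => Or.inl (Or.inr rfl)⟩
    · exact hincl (Sum.inr x)
  ext u v
  constructor
  · rintro (⟨hu, hv⟩ | ⟨p, q, rfl, rfl, (rfl | ⟨h, -⟩)⟩)
    · exact γ.trans' ((key u).1 hu) (γ.symm' ((key v).1 hv))
    · exact γ.refl' _
    · exact h
  · intro h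
    by_cases hu : γ u (Sum.inl none)
    · exact Or.inl ⟨(key u).2 hu, (key v).2 (γ.trans' (γ.symm' h) hu)⟩
    · have hv : ¬ γ v (Sum.inl none) := fun hv => hu (γ.trans' h hv)
      have : ∀ w, ¬ γ w (Sum.inl none) → ∃ p, w = incl p := by
        rintro ((_ | x) | (_ | x)) hw
        · exact absurd (γ.refl' _) hw
        · exact ⟨Sum.inl x, rfl⟩
        · exact absurd (γ.symm' h0) hw
        · exact ⟨Sum.inr x, rfl⟩
      obtain ⟨p, rfl⟩ := this u hu
      obtain ⟨q, rfl⟩ := this v hv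
      exact Or.inr ⟨p, q, rfl, rfl, Or.inr ⟨h, hu⟩⟩

theorem bar_mul (α β : PIStar X) : (α * β).bar = naturalMul α.bar β.bar :=
  bar_unbar _ _ _

theorem bar_injective : Function.Injective (bar (X := X)) := by
  have key : ∀ α : PIStar X, ∀ p q, α.rel p q ↔
      p = q ∨ (α.bar (incl p) (incl q) ∧ ¬ α.bar (incl p) (Sum.inl none)) := by
    intro α p q
    have hx : α.bar (incl p) (Sum.inl none) ↔ incl p ∈ α.extraBlock := by
      constructor
      · rintro (⟨h, -⟩ | ⟨_, (q | q), _, h, _⟩)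
        · exact h
        · cases h
        · cases h
      · exact fun h => Or.inl ⟨h, Or.inl (Or.inl rfl)⟩
    rw [hx]
    constructor
    · intro h
      by_cases hp : incl p ∈ α.extraBlock
      · exact Or.inl (extraBlock_eq_of_rel α h hp).symm
      · exact Or.inr ⟨Or.inr ⟨p, q, rfl, rfl, h⟩, hp⟩
    · rintro (rfl | ⟨⟨h, -⟩ | ⟨p', q', hp, hq, h⟩, hn⟩)
      · exact α.rel.refl' _
      · exact absurd h hn
      · rwa [incl_injective hp, incl_injective hq]
  intro α β h
  ext p q
  rw [key α, key β, h]

/-- Gluing an equivalence relation `E` on `A` to an equivalence relation `H` on `B` along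
the common part `W` does not change `H`, if `H` contains `E` on the common part. -/
theorem comap_glue {A B W P : Type*} {i : A → P} {j : B → P} {f : W → A} {g : W → B}
    (hi : Function.Injective i) (hj : Function.Injective j)
    (hW : ∀ a b, i a = j b → ∃ w, a = f w ∧ b = g w) (E : Setoid A) (H : Setoid B)
    (hEH : Setoid.comap f E ≤ Setoid.comap g H) :
    Setoid.comap j (Setoid.map E i ⊔ Setoid.map H j) ≤ H := by
  intro b b₁ hb
  let N : P → B → Prop := fun p c => j c = p ∨ ∃ a w, i a = p ∧ E a (f w) ∧ c = g w
  have hN : ∀ c d, N (j c) d → H c d := by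
    rintro c d (h | ⟨a, w, h, hE, rfl⟩)
    · rw [hj h]
    · obtain ⟨w', rfl, rfl⟩ := hW _ _ h
      exact hEH hE
  let Q : P → Prop := fun p => ∃ c, N p c ∧ H b c
  let K : Setoid P := Setoid.comap Q ⊥
  have hK : ∀ p q, (Q p → Q q) → (Q q → Q p) → K p q := fun p q h1 h2 => propext ⟨h1, h2⟩
  have stepE : ∀ a a', E a a' → Q (i a) → Q (i a') := by
    rintro a a' h ⟨c, (hc | ⟨a₂, w, h₂, hE, rfl⟩), hbc⟩
    · obtain ⟨w, rfl, rfl⟩ := hW _ _ hc.symm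
      exact ⟨_, Or.inr ⟨a', w, rfl, E.symm' h, rfl⟩, hbc⟩
    · rw [hi h₂] at hE
      exact ⟨_, Or.inr ⟨a', w, rfl, E.trans' (E.symm' h) hE, rfl⟩, hbc⟩
  have stepH : ∀ c c', H c c' → Q (j c) → Q (j c') := by
    rintro c c' h ⟨d, hd, hbd⟩
    exact ⟨c', Or.inl rfl, H.trans' hbd (H.trans' (H.symm' (hN _ _ hd)) h)⟩
  have hle : Setoid.map E i ⊔ Setoid.map H j ≤ K := by
    refine sup_le (Setoid.eqvGen_le ?_) (Setoid.eqvGen_le ?_)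
    · rintro _ _ ⟨a, a', h, rfl, rfl⟩
      exact hK _ _ (stepE _ _ h) (stepE _ _ (E.symm' h))
    · rintro _ _ ⟨a, a', h, rfl, rfl⟩
      exact hK _ _ (stepH _ _ h) (stepH _ _ (H.symm' h))
  have : Q (j b) = Q (j b₁) := hle hb
  have hb0 : Q (j b) := ⟨b, Or.inl rfl, H.refl' b⟩
  rw [this] at hb0
  obtain ⟨c, hc, hbc⟩ := hb0
  exact H.trans' hbc (H.symm' (hN _ _ hc))

theorem map_le_iff {A B : Type*} {f : A → B} {r : Setoid A} {s : Setoid B} :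
    Setoid.map r f ≤ s ↔ r ≤ Setoid.comap f s := by
  constructor
  · exact fun h a b hab => h (Relation.EqvGen.rel _ _ ⟨a, b, hab, rfl, rfl⟩)
  · intro h
    refine Setoid.eqvGen_le ?_
    rintro _ _ ⟨a, b, hab, rfl, rfl⟩
    exact h hab

theorem naturalMul_assoc {Y : Type*} (α β γ : Setoid (Y ⊕ Y)) :
    naturalMul (naturalMul α β) γ = naturalMul α (naturalMul β γ) := by
  let k12 : Y ⊕ Y → Y ⊕ (Y ⊕ (Y ⊕ Y)) := Sum.map id Sum.inl
  let k23 : Y ⊕ Y → Y ⊕ (Y ⊕ (Y ⊕ Y)) := Sum.inr ∘ Sum.map id Sum.inl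
  let k34 : Y ⊕ Y → Y ⊕ (Y ⊕ (Y ⊕ Y)) := Sum.inr ∘ Sum.inr
  let k14 : Y ⊕ Y → Y ⊕ (Y ⊕ (Y ⊕ Y)) := Sum.map id (Sum.inr ∘ Sum.inr)
  let G : Setoid (Y ⊕ (Y ⊕ (Y ⊕ Y))) :=
    Setoid.map α k12 ⊔ Setoid.map β k23 ⊔ Setoid.map γ k34
  have gα : α ≤ Setoid.comap k12 G := map_le_iff.1 (le_sup_left.trans le_sup_left)
  have gβ : β ≤ Setoid.comap k23 G := map_le_iff.1 (le_sup_right.trans le_sup_left)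
  have gγ : γ ≤ Setoid.comap k34 G := map_le_iff.1 le_sup_right
  have left : naturalMul (naturalMul α β) γ = Setoid.comap k14 G := by
    let i : Y ⊕ (Y ⊕ Y) → Y ⊕ (Y ⊕ (Y ⊕ Y)) := Sum.map id (Sum.map id Sum.inl)
    let j : Y ⊕ (Y ⊕ Y) → Y ⊕ (Y ⊕ (Y ⊕ Y)) := Sum.map id Sum.inr
    let E := Setoid.map α upper ⊔ Setoid.map β lower
    let H := Setoid.map (naturalMul α β) upper ⊔ Setoid.map γ lower
    have hi : Function.Injective i := by
      rintro (a | a | a) (b | b | b) h <;> simp_all [i]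
    have hj : Function.Injective j := by
      rintro (a | a | a) (b | b | b) h <;> simp_all [j]
    have hW : ∀ a b, i a = j b → ∃ w, a = outer w ∧ b = upper w := by
      rintro (a | a | a) (b | b | b) h <;> simp_all [i, j, outer, upper]
    have hEi : E ≤ Setoid.comap i G := by
      refine sup_le (map_le_iff.2 ?_) (map_le_iff.2 ?_)
      · rintro (a | a) (b | b) h <;> exact gα h
      · rintro (a | a) (b | b) h <;> exact gβ h
    have hHj : H ≤ Setoid.comap j G := by
      refine sup_le (map_le_iff.2 ?_) (map_le_iff.2 ?_)
      · rintro (a | a) (b | b) h <;> exact hEi h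
      · rintro (a | a) (b | b) h <;> exact gγ h
    have hG : G ≤ Setoid.map E i ⊔ Setoid.map H j := by
      have e1 : E ≤ Setoid.comap i (Setoid.map E i ⊔ Setoid.map H j) := map_le_iff.1 le_sup_left
      have e2 : H ≤ Setoid.comap j (Setoid.map E i ⊔ Setoid.map H j) := map_le_iff.1 le_sup_right
      have eα : α ≤ Setoid.comap upper E := map_le_iff.1 le_sup_left
      have eβ : β ≤ Setoid.comap lower E := map_le_iff.1 le_sup_right
      have eγ : γ ≤ Setoid.comap lower H := map_le_iff.1 le_sup_right
      refine sup_le (sup_le (map_le_iff.2 ?_) (map_le_iff.2 ?_)) (map_le_iff.2 ?_)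
      · rintro (a | a) (b | b) h <;> exact e1 (eα h)
      · rintro (a | a) (b | b) h <;> exact e1 (eβ h)
      · rintro (a | a) (b | b) h <;> exact e2 (eγ h)
    have hle : Setoid.comap j (Setoid.map E i ⊔ Setoid.map H j) ≤ H :=
      comap_glue hi hj hW E H (map_le_iff.1 le_sup_left)
    ext p q
    constructor
    · intro h
      have := hHj (show H (outer p) (outer q) from h)
      rcases p with p | p <;> rcases q with q | q <;> exact this
    · intro h
      have : G (j (outer p)) (j (outer q)) := by
        rcases p with p | p <;> rcases q with q | q <;> exact h
      exact hle (hG this)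
  have right : naturalMul α (naturalMul β γ) = Setoid.comap k14 G := by
    let i : Y ⊕ (Y ⊕ Y) → Y ⊕ (Y ⊕ (Y ⊕ Y)) := Sum.inr
    let j : Y ⊕ (Y ⊕ Y) → Y ⊕ (Y ⊕ (Y ⊕ Y)) := Sum.map id (Sum.map id Sum.inr)
    let E := Setoid.map β upper ⊔ Setoid.map γ lower
    let H := Setoid.map α upper ⊔ Setoid.map (naturalMul β γ) lower
    have hi : Function.Injective i := Sum.inr_injective
    have hj : Function.Injective j := by
      rintro (a | a | a) (b | b | b) h <;> simp_all [j]
    have hW : ∀ a b, i a = j b → ∃ w, a = outer w ∧ b = lower w := by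
      rintro (a | a | a) (b | b | b) h <;> simp_all [i, j, outer, lower]
    have hEi : E ≤ Setoid.comap i G := by
      refine sup_le (map_le_iff.2 ?_) (map_le_iff.2 ?_)
      · rintro (a | a) (b | b) h <;> exact gβ h
      · rintro (a | a) (b | b) h <;> exact gγ h
    have hHj : H ≤ Setoid.comap j G := by
      refine sup_le (map_le_iff.2 ?_) (map_le_iff.2 ?_)
      · rintro (a | a) (b | b) h <;> exact gα h
      · rintro (a | a) (b | b) h <;> exact hEi h
    have hG : G ≤ Setoid.map E i ⊔ Setoid.map H j := by
      have e1 : E ≤ Setoid.comap i (Setoid.map E i ⊔ Setoid.map H j) := map_le_iff.1 le_sup_left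
      have e2 : H ≤ Setoid.comap j (Setoid.map E i ⊔ Setoid.map H j) := map_le_iff.1 le_sup_right
      have eα : α ≤ Setoid.comap upper H := map_le_iff.1 le_sup_left
      have eβ : β ≤ Setoid.comap upper E := map_le_iff.1 le_sup_left
      have eγ : γ ≤ Setoid.comap lower E := map_le_iff.1 le_sup_right
      refine sup_le (sup_le (map_le_iff.2 ?_) (map_le_iff.2 ?_)) (map_le_iff.2 ?_)
      · rintro (a | a) (b | b) h <;> exact e2 (eα h)
      · rintro (a | a) (b | b) h <;> exact e1 (eβ h)
      · rintro (a | a) (b | b) h <;> exact e1 (eγ h)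
    have hle : Setoid.comap j (Setoid.map E i ⊔ Setoid.map H j) ≤ H :=
      comap_glue hi hj hW E H (map_le_iff.1 le_sup_right)
    ext p q
    constructor
    · intro h
      have := hHj (show H (outer p) (outer q) from h)
      rcases p with p | p <;> rcases q with q | q <;> exact this
    · intro h
      have : G (j (outer p)) (j (outer q)) := by
        rcases p with p | p <;> rcases q with q | q <;> exact h
      exact hle (hG this)
  rw [left, right]

/-- `PI*_X` is a semigroup. -/
instance : Semigroup (PIStar X) where
  mul_assoc α β γ := bar_injective (by simp only [bar_mul, naturalMul_assoc])

/-- The partition with the blocks `{x, π(x)'}` given by a permutation `π` of `X`. -/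
def ofPerm (π : Equiv.Perm X) : PIStar X where
  rel := Setoid.ker (Sum.elim π id)
  point_or_line := by
    rintro A ⟨(x | y), rfl⟩
    · exact Or.inr ⟨⟨x, rfl⟩, ⟨π x, rfl⟩⟩
    · exact Or.inr ⟨⟨π.symm y, π.apply_symm_apply y⟩, ⟨y, rfl⟩⟩

/-- The symmetric group as a subset of `PI*_X`. -/
def symmetricGroup (X : Type*) : Set (PIStar X) := Set.range ofPerm

end PIStar

/-- A (nonempty) subsemigroup `T` of `S` is completely isolated if `a * b ∈ T` implies `a ∈ T`
or `b ∈ T`. Nonemptiness is demanded since Mathlib's `Subsemigroup` may be empty. -/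
def IsCompletelyIsolated {S : Type*} [Semigroup S] (T : Subsemigroup S) : Prop :=
  (T : Set S).Nonempty ∧ ∀ a b : S, a * b ∈ T → a ∈ T ∨ b ∈ T

namespace PIStar

variable {X : Type*}

/-! ### Products of partitions -/

/-! Read contrapositively, complete isolation says that the complement of `T` is closed under
multiplication. So the task is to find all splittings: nonempty sets `A` such that `A` and its
complement are both closed under multiplication.

The semigroup is finite, so every nonempty subset closed under multiplication contains an
idempotent. The idempotents are the `idem E`, one for each equivalence relation `E` on `X ∪ {x̄}`,
and they multiply by joins (`exists_eq_idem`, `idem_mul_idem`). Those with `E ≠ ⊥` are therefore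
products of atoms, which identify just two vertices.

All atoms lie on the same side of a splitting. An element lies on the side of its square, so if `a *
a = b * b`, then `a * b` and `b * a` lie on one side (`IsSplitting.mul_comm_mem_iff`). Two maps `f`,
`g` with equal range yield such a pair `a`, `b`, for which `a * b` and `b * a` are the idempotents
of `ker f` and `ker g` (`IsSplitting.idem_ker_mem_iff`).

Hence all nonidentity idempotents share a side. The units on the side opposite to the identity, and
the nonunits on the side opposite to the atoms, would form subsemigroups without idempotents, so
there are none. The sides of the identity and of a single atom thus determine `A`. -/

theorem le_comap_upper {Y : Type*} (r s : Setoid (Y ⊕ Y)) :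
    r ≤ Setoid.comap upper (Setoid.map r upper ⊔ Setoid.map s lower) :=
  map_le_iff.1 le_sup_left

theorem le_comap_lower {Y : Type*} (r s : Setoid (Y ⊕ Y)) :
    s ≤ Setoid.comap lower (Setoid.map r upper ⊔ Setoid.map s lower) :=
  map_le_iff.1 le_sup_right

/-- Products are bounded above by exhibiting a relation on the three layers that contains both
factors, typically the kernel of a labelling of the vertices. -/
theorem naturalMul_le {Y : Type*} {r s : Setoid (Y ⊕ Y)} {t : Setoid (Y ⊕ (Y ⊕ Y))}
    (hr : r ≤ Setoid.comap upper t) (hs : s ≤ Setoid.comap lower t) :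
    naturalMul r s ≤ Setoid.comap outer t := fun _ _ h =>
  sup_le (map_le_iff.2 hr) (map_le_iff.2 hs) h

theorem naturalMul_inl_inl {Y : Type*} {r s : Setoid (Y ⊕ Y)} {x y : Y}
    (h : r (Sum.inl x) (Sum.inl y)) : naturalMul r s (Sum.inl x) (Sum.inl y) :=
  le_comap_upper r s h

theorem naturalMul_inl_inr {Y : Type*} {r s : Setoid (Y ⊕ Y)} {x m y : Y}
    (h : r (Sum.inl x) (Sum.inr m)) (h' : s (Sum.inl m) (Sum.inr y)) :
    naturalMul r s (Sum.inl x) (Sum.inr y) :=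
  (Setoid.map r upper ⊔ Setoid.map s lower).trans' (le_comap_upper r s h) (le_comap_lower r s h')

/-- A partition into generalised lines is determined from below by its lines. -/
theorem le_of_inl_inr {Y : Type*} {r s : Setoid (Y ⊕ Y)}
    (hr : ∀ A ∈ r.classes, IsGeneralisedLine A)
    (h : ∀ x y, r (Sum.inl x) (Sum.inr y) → s (Sum.inl x) (Sum.inr y)) : r ≤ s := by
  rintro (x | x) (y | y) hxy
  · obtain ⟨z, hz⟩ := (hr _ ⟨Sum.inl x, rfl⟩).2
    exact s.trans' (h _ _ (r.symm' hz)) (s.symm' (h _ _ (r.trans' (r.symm' hxy) (r.symm' hz))))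
  · exact h _ _ hxy
  · exact s.symm' (h _ _ (r.symm' hxy))
  · obtain ⟨z, hz⟩ := (hr _ ⟨Sum.inr x, rfl⟩).1
    exact s.trans' (s.symm' (h _ _ hz)) (h _ _ (r.trans' hz hxy))

/-! ### Elements given by a pair of maps -/

/-- The element of `PI*_X` whose extended partition is the kernel of `f` on the top vertices
and `g` on the bottom vertices. -/
def ofMaps {Y : Type*} (f g : Option X → Y) (h : Set.range f = Set.range g)
    (h0 : f none = g none) : PIStar X :=
  unbar (Setoid.ker (Sum.elim f g))
    (by
      rintro A ⟨(x | x), rfl⟩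
      · obtain ⟨y, hy⟩ : f x ∈ Set.range g := h ▸ Set.mem_range_self x
        exact ⟨⟨x, rfl⟩, ⟨y, hy⟩⟩
      · obtain ⟨y, hy⟩ : g x ∈ Set.range f := h ▸ Set.mem_range_self x
        exact ⟨⟨y, hy⟩, ⟨x, rfl⟩⟩) h0

theorem bar_ofMaps {Y : Type*} (f g : Option X → Y) (h : Set.range f = Set.range g)
    (h0 : f none = g none) : (ofMaps f g h h0).bar = Setoid.ker (Sum.elim f g) :=
  bar_unbar _ _ _

/-- Label the three layers by `f`, `g`, `k`: edges preserve labels, and equality of ranges supplies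
a middle vertex with any label that occurs. -/
theorem ofMaps_mul_ofMaps {Y : Type*} {f g k : Option X → Y} (h : Set.range f = Set.range g)
    (h0 : f none = g none) (h' : Set.range g = Set.range k) (h0' : g none = k none) :
    ofMaps f g h h0 * ofMaps g k h' h0' = ofMaps f k (h.trans h') (h0.trans h0') := by
  refine bar_injective (le_antisymm ?_ (le_of_inl_inr (bar_isGeneralisedLine _) ?_))
  · rw [bar_mul, bar_ofMaps, bar_ofMaps, bar_ofMaps]
    refine (naturalMul_le (t := Setoid.ker (Sum.elim f (Sum.elim g k))) ?_ ?_).trans ?_ <;>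
    · rintro (x | x) (y | y) hxy <;> exact hxy
  · intro x y hxy
    rw [bar_ofMaps] at hxy
    rw [bar_mul, bar_ofMaps, bar_ofMaps]
    obtain ⟨m, hm⟩ : f x ∈ Set.range g := h ▸ Set.mem_range_self x
    exact naturalMul_inl_inr hm.symm (hm.trans hxy)

/-! ### Idempotents -/

/-- The idempotent of `PI*_X` given by an equivalence relation on `X ∪ {x̄}`. -/
def idem (E : Setoid (Option X)) : PIStar X :=
  ofMaps (Quotient.mk E) (Quotient.mk E) rfl rfl

theorem bar_idem (E : Setoid (Option X)) :
    (idem E).bar = Setoid.comap (Sum.elim id id) E := by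
  rw [idem, bar_ofMaps]
  ext u v
  rcases u with u | u <;> rcases v with v | v <;> exact Quotient.eq (r := E)

theorem idem_ker {Y : Type*} (f : Option X → Y) : idem (Setoid.ker f) = ofMaps f f rfl rfl := by
  apply bar_injective
  rw [bar_idem, bar_ofMaps]
  ext u v
  rcases u with u | u <;> rcases v with v | v <;> exact Iff.rfl

/-- Vertical lines identify all three layers with the middle one, where `E` and `F` together
generate the join. -/
theorem idem_mul_idem (E F : Setoid (Option X)) : idem E * idem F = idem (E ⊔ F) := by
  refine bar_injective (le_antisymm ?_ (le_of_inl_inr (bar_isGeneralisedLine _) ?_))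
  · rw [bar_mul, bar_idem, bar_idem, bar_idem]
    refine (naturalMul_le
      (t := Setoid.comap (Sum.elim id (Sum.elim id id)) (E ⊔ F)) ?_ ?_).trans ?_
    · rintro (x | x) (y | y) hxy <;> exact (le_sup_left : E ≤ E ⊔ F) hxy
    · rintro (x | x) (y | y) hxy <;> exact (le_sup_right : F ≤ E ⊔ F) hxy
    · rintro (x | x) (y | y) hxy <;> exact hxy
  · intro x y hxy
    rw [bar_idem] at hxy
    rw [bar_mul, bar_idem, bar_idem]
    let r := Setoid.comap (Sum.elim id id) E
    let s := Setoid.comap (Sum.elim id id) F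
    let G := Setoid.map r upper ⊔ Setoid.map s lower
    have hE : E ≤ Setoid.comap (fun m => Sum.inr (Sum.inl m)) G := fun a b hab =>
      le_comap_upper r s (show r (Sum.inr a) (Sum.inr b) from hab)
    have hF : F ≤ Setoid.comap (fun m => Sum.inr (Sum.inl m)) G := fun a b hab =>
      le_comap_lower r s (show s (Sum.inl a) (Sum.inl b) from hab)
    have h1 : G (Sum.inl x) (Sum.inr (Sum.inl x)) :=
      le_comap_upper r s (show r (Sum.inl x) (Sum.inr x) from E.refl' x)
    have h2 : G (Sum.inr (Sum.inl y)) (Sum.inr (Sum.inr y)) :=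
      le_comap_lower r s (show s (Sum.inl y) (Sum.inr y) from F.refl' y)
    exact G.trans' h1 (G.trans' (sup_le hE hF hxy) h2)

/-- Idempotency lets lines compose: `x ~ m'` and `m ~ y'` give `x ~ y'`. This transfers relations
from the top to the bottom and forces `x ~ x'`, so the partition is pulled back from its restriction
to the top layer. -/
theorem exists_eq_idem {a : PIStar X} (ha : a * a = a) : ∃ E, a = idem E := by
  have hbar : naturalMul a.bar a.bar = a.bar := by rw [← bar_mul, ha]
  set γ := a.bar with hγ
  have hline := a.bar_isGeneralisedLine
  have top : ∀ x, ∃ y, γ (Sum.inl x) (Sum.inr y) := fun x => by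
    obtain ⟨y, hy⟩ := (hline _ ⟨Sum.inl x, rfl⟩).2
    exact ⟨y, γ.symm' hy⟩
  have bot : ∀ y, ∃ x, γ (Sum.inl x) (Sum.inr y) := fun y => (hline _ ⟨Sum.inr y, rfl⟩).1
  have comp : ∀ {x m y}, γ (Sum.inl x) (Sum.inr m) → γ (Sum.inl m) (Sum.inr y) →
      γ (Sum.inl x) (Sum.inr y) := fun h h' => by
    have := naturalMul_inl_inr h h'
    rwa [hbar] at this
  have htb : ∀ {u v}, γ (Sum.inl u) (Sum.inl v) → γ (Sum.inr u) (Sum.inr v) := by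
    intro u v h
    obtain ⟨p, hp⟩ := bot u
    obtain ⟨q, hq⟩ := bot v
    obtain ⟨z, hz⟩ := top u
    have h1 := comp hp hz
    have h2 := comp hq (γ.trans' (γ.symm' h) hz)
    exact γ.trans' (γ.symm' hp) (γ.trans' h1 (γ.trans' (γ.symm' h2) hq))
  have hbt : ∀ {u v}, γ (Sum.inr u) (Sum.inr v) → γ (Sum.inl u) (Sum.inl v) := by
    intro u v h
    obtain ⟨p, hp⟩ := top u
    obtain ⟨q, hq⟩ := top v
    obtain ⟨z, hz⟩ := bot u
    have h1 := comp hz hp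
    have h2 := comp (γ.trans' hz h) hq
    exact γ.trans' hp (γ.trans' (γ.symm' h1) (γ.trans' h2 (γ.symm' hq)))
  have diag : ∀ x, γ (Sum.inl x) (Sum.inr x) := by
    intro x
    obtain ⟨y, hy⟩ := top x
    obtain ⟨z, hz⟩ := top y
    have h1 : γ (Sum.inr y) (Sum.inr z) := γ.trans' (γ.symm' hy) (comp hy hz)
    have h2 : γ (Sum.inl x) (Sum.inl y) := γ.trans' hy (γ.trans' h1 (γ.symm' hz))
    exact γ.trans' hy (γ.symm' (htb h2))
  refine ⟨Setoid.comap Sum.inl γ, bar_injective ?_⟩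
  rw [bar_idem, ← hγ]
  have hd : ∀ u : Option X ⊕ Option X, γ (Sum.inl (Sum.elim id id u)) u := by
    rintro (x | x)
    · exact γ.refl' _
    · exact diag x
  ext u v
  exact ⟨fun h => γ.trans' (hd u) (γ.trans' h (γ.symm' (hd v))),
    fun h => γ.trans' (γ.symm' (hd u)) (γ.trans' h (hd v))⟩

/-! ### The symmetric group -/

/-- A permutation has no points, so the extra block is just `{x̄, x̄'}`; hence the extension of `π`
fixing `none`. -/
theorem bar_ofPerm (π : Equiv.Perm X) :
    (ofPerm π).bar = Setoid.ker (Sum.elim (Option.map π) id) := by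
  have hr : Set.range (Option.map π) = Set.range (id : Option X → Option X) := by
    rw [Set.range_id]
    exact (Equiv.optionCongr π).surjective.range_eq
  have : ofPerm π = ofMaps (Option.map π) id hr rfl := by
    ext p q
    constructor
    · intro h
      refine Or.inr ⟨?_, ?_⟩
      · rcases p with p | p <;> rcases q with q | q <;> exact congrArg some h
      · rcases p with p | p <;> exact Option.some_ne_none _
    · rintro (rfl | ⟨h, -⟩)
      · exact (ofPerm π).rel.refl' _
      · rcases p with p | p <;> rcases q with q | q <;> exact Option.some_injective _ h
  rw [this, bar_ofMaps]

/-- If the top vertices are separated, none of them is a point, since points are joined to `x̄`.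
Each is then joined to a bottom vertex, and the resulting injection of `X` into itself is bijective
by finiteness, leaving no other bottom vertex. -/
theorem mem_symmetricGroup_iff [Finite X] {a : PIStar X} :
    a ∈ symmetricGroup X ↔ ∀ x y, a.bar (Sum.inl x) (Sum.inl y) → x = y := by
  constructor
  · rintro ⟨π, rfl⟩ x y h
    rw [bar_ofPerm] at h
    exact Option.map_injective π.injective h
  · intro h
    have hex : ∀ x, ∃ y, a.rel (Sum.inl x) (Sum.inr y) := by
      intro x
      rcases a.point_or_line _ ⟨Sum.inl x, rfl⟩ with ⟨p, hp⟩ | ⟨-, y, hy⟩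
      · have hx : Sum.inl x ∈ ({p} : Set (X ⊕ X)) := hp ▸ a.rel.refl' (Sum.inl x)
        cases hx
        exact absurd (h (some x) none
          (Or.inl ⟨Or.inr ⟨Sum.inl x, rfl, ⟨_, hp.symm⟩⟩, Or.inl (Or.inl rfl)⟩))
          (Option.some_ne_none x)
      · exact ⟨y, a.rel.symm' hy⟩
    choose φ hφ using hex
    have hinl : ∀ x y, a.rel (Sum.inl x) (Sum.inl y) → x = y := fun x y hxy =>
      Option.some_injective _ (h _ _ (Or.inr ⟨Sum.inl x, Sum.inl y, rfl, rfl, hxy⟩))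
    have hinj : Function.Injective φ := fun x y hxy =>
      hinl x y (a.rel.trans' (hφ x) (hxy ▸ a.rel.symm' (hφ y)))
    let π : Equiv.Perm X := Equiv.ofBijective φ (Finite.injective_iff_bijective.1 hinj)
    have hπ : ∀ p, a.rel (Sum.inl (π.symm (Sum.elim π id p))) p := by
      rintro (x | y)
      · simp
      · have := hφ (π.symm y)
        rwa [show φ (π.symm y) = y from π.apply_symm_apply y] at this
    refine ⟨π, ?_⟩
    ext p q
    constructor
    · intro hpq
      have hpq : Sum.elim π id p = Sum.elim π id q := hpq
      exact a.rel.trans' (a.rel.symm' (hπ p)) (hpq ▸ hπ q)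
    · intro hpq
      exact π.symm.injective
        (hinl _ _ (a.rel.trans' (hπ p) (a.rel.trans' hpq (a.rel.symm' (hπ q)))))

theorem mul_mem_symmetricGroup {a b : PIStar X} (ha : a ∈ symmetricGroup X)
    (hb : b ∈ symmetricGroup X) : a * b ∈ symmetricGroup X := by
  obtain ⟨π, rfl⟩ := ha
  obtain ⟨ρ, rfl⟩ := hb
  refine ⟨π.trans ρ, bar_injective (le_antisymm (le_of_inl_inr (bar_isGeneralisedLine _) ?_) ?_)⟩
  · intro x y h
    rw [bar_ofPerm] at h
    have h : Option.map (π.trans ρ) x = y := h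
    rw [bar_mul, bar_ofPerm, bar_ofPerm]
    refine naturalMul_inl_inr (m := Option.map π x) rfl ?_
    change Option.map ρ (Option.map π x) = y
    rw [← h, Option.map_map]
    rfl
  · rw [bar_mul, bar_ofPerm, bar_ofPerm, bar_ofPerm]
    -- Each vertex is labelled by the bottom vertex that it reaches.
    refine (naturalMul_le (t := Setoid.ker
      (Sum.elim (Option.map (π.trans ρ)) (Sum.elim (Option.map ρ) id))) ?_ ?_).trans ?_
    · have key : ∀ u : Option X ⊕ Option X,
          Sum.elim (Option.map (π.trans ρ)) (Sum.elim (Option.map ρ) id) (upper u) =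
            Option.map ρ (Sum.elim (Option.map π) id u) := by
        rintro ((_ | x) | (_ | x)) <;> rfl
      intro u v h
      change _ = _
      rw [key, key]
      exact congrArg _ h
    · rintro (x | x) (y | y) hxy <;> exact hxy
    · rintro (x | x) (y | y) hxy <;> exact hxy

/-- Top vertices joined in `a` remain joined in `a * b`. -/
theorem left_mem_symmetricGroup_of_mul [Finite X] {a b : PIStar X}
    (h : a * b ∈ symmetricGroup X) : a ∈ symmetricGroup X := by
  rw [mem_symmetricGroup_iff] at h ⊢
  intro x y hxy
  refine h x y ?_
  rw [bar_mul]
  exact naturalMul_inl_inl hxy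

theorem idem_mem_symmetricGroup_iff [Finite X] {E : Setoid (Option X)} :
    idem E ∈ symmetricGroup X ↔ E = ⊥ := by
  rw [mem_symmetricGroup_iff, bar_idem, eq_bot_iff]
  exact ⟨fun h x y hxy => h x y hxy, fun h x y hxy => h hxy⟩

/-! ### Partitions of the semigroup into two subsemigroups -/

/-- A subset which is closed under multiplication together with its complement. -/
structure IsSplitting {S : Type*} [Mul S] (A : Set S) : Prop where
  mul_mem : ∀ a ∈ A, ∀ b ∈ A, a * b ∈ A
  mul_notMem : ∀ a ∉ A, ∀ b ∉ A, a * b ∉ A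

theorem IsSplitting.compl {S : Type*} [Mul S] {A : Set S} (h : IsSplitting A) :
    IsSplitting Aᶜ :=
  ⟨h.mul_notMem, fun a ha b hb hab =>
    hab (h.mul_mem a (not_not.1 ha) b (not_not.1 hb))⟩

theorem IsSplitting.mul_self_mem_iff {S : Type*} [Mul S] {A : Set S} (h : IsSplitting A)
    (a : S) : a * a ∈ A ↔ a ∈ A :=
  ⟨fun ha => by_contra fun hn => h.mul_notMem a hn a hn ha, fun ha => h.mul_mem a ha a ha⟩

/-- Both `a` and `b` lie on the side of their common square, and that side is closed under products
in either order. -/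
theorem IsSplitting.mul_comm_mem_iff {S : Type*} [Mul S] {A : Set S} (h : IsSplitting A)
    {a b : S} (hab : a * a = b * b) : a * b ∈ A ↔ b * a ∈ A := by
  have hiff : a ∈ A ↔ b ∈ A := by
    rw [← h.mul_self_mem_iff a, hab, h.mul_self_mem_iff b]
  by_cases ha : a ∈ A
  · have hb := hiff.1 ha
    exact ⟨fun _ => h.mul_mem b hb a ha, fun _ => h.mul_mem a ha b hb⟩
  · have hb := fun hb => ha (hiff.2 hb)
    exact ⟨fun h' => absurd h' (h.mul_notMem a ha b hb),
      fun h' => absurd h' (h.mul_notMem b hb a ha)⟩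

/-! ### Idempotents on the two sides of a splitting -/

theorem exists_idempotent_mem {S : Type*} [Semigroup S] [Finite S] {A : Set S}
    (hA : A.Nonempty) (hmul : ∀ a ∈ A, ∀ b ∈ A, a * b ∈ A) : ∃ e ∈ A, e * e = e := by
  -- With the discrete topology a finite semigroup is compact, and the Ellis–Numakura theorem
  -- applies.
  let : TopologicalSpace S := ⊥
  have : DiscreteTopology S := ⟨rfl⟩
  exact exists_idempotent_in_compact_subsemigroup (fun _ => continuous_of_discreteTopology)
    A hA A.toFinite.isCompact hmul

instance [Finite X] : Finite (PIStar X) :=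
  Finite.of_injective (fun (a : PIStar X) p q => a.rel p q) fun a b h => by
    ext p q
    exact iff_of_eq (congrFun (congrFun h p) q)

theorem exists_idem_mem [Finite X] {A : Set (PIStar X)} (hA : A.Nonempty)
    (hmul : ∀ a ∈ A, ∀ b ∈ A, a * b ∈ A) : ∃ E, idem E ∈ A := by
  obtain ⟨e, he, hee⟩ := exists_idempotent_mem hA hmul
  obtain ⟨E, rfl⟩ := exists_eq_idem hee
  exact ⟨E, he⟩

/-- Units outside `A` would form a subsemigroup, but its idempotent could only be the identity `idem
⊥`. -/
theorem symmetricGroup_subset_of_idem_bot_mem [Finite X] {A : Set (PIStar X)}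
    (hA : IsSplitting A) (h : idem ⊥ ∈ A) : symmetricGroup X ⊆ A := by
  by_contra hn
  obtain ⟨a, ha, haA⟩ := Set.not_subset.1 hn
  obtain ⟨E, hE, hEA⟩ := exists_idem_mem (A := symmetricGroup X ∩ Aᶜ) ⟨a, ha, haA⟩
    fun x hx y hy => ⟨mul_mem_symmetricGroup hx.1 hy.1, hA.mul_notMem x hx.2 y hy.2⟩
  rw [idem_mem_symmetricGroup_iff] at hE
  exact hEA (hE ▸ h)

/-- On the middle layer the first factor contributes `ker g` and the second `ker f`, generating the
join `R`. As `f` and `g` move vertices only within `R`-classes, every line of the factors stays in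
one class. The result is symmetric in `f` and `g`. -/
theorem ofMaps_mul_self {f g : Option X → Option X} (h : Set.range f = Set.range g)
    (h0 : f none = g none) (hf : ∀ x, (Setoid.ker f ⊔ Setoid.ker g) (f x) x)
    (hg : ∀ x, (Setoid.ker f ⊔ Setoid.ker g) (g x) x) :
    ofMaps f g h h0 * ofMaps f g h h0 = idem (Setoid.ker f ⊔ Setoid.ker g) := by
  set R := Setoid.ker f ⊔ Setoid.ker g with hR
  have hfR : ∀ {x y}, f x = f y → R x y := fun h => (le_sup_left : Setoid.ker f ≤ R) h
  have hgR : ∀ {x y}, g x = g y → R x y := fun h => (le_sup_right : Setoid.ker g ≤ R) h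
  have hfgR : ∀ {x y}, f x = g y → R x y := fun {x y} h =>
    R.trans' (R.symm' (hf x)) (h ▸ hg y)
  refine bar_injective (le_antisymm ?_ (le_of_inl_inr (bar_isGeneralisedLine _) ?_))
  · rw [bar_mul, bar_ofMaps, bar_idem]
    have hle : Setoid.ker (Sum.elim f g) ≤ Setoid.comap (Sum.elim id id) R := by
      rintro (x | x) (y | y) hxy
      · exact hfR hxy
      · exact hfgR hxy
      · exact R.symm' (hfgR hxy.symm)
      · exact hgR hxy
    refine (naturalMul_le (t := Setoid.comap (Sum.elim id (Sum.elim id id)) R) ?_ ?_).trans ?_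
    · rintro (x | x) (y | y) hxy <;> exact hle hxy
    · rintro (x | x) (y | y) hxy <;> exact hle hxy
    · rintro (x | x) (y | y) hxy <;> exact hxy
  · intro x y hxy
    rw [bar_idem] at hxy
    rw [bar_mul, bar_ofMaps]
    let r := Setoid.ker (Sum.elim f g)
    let G := Setoid.map r upper ⊔ Setoid.map r lower
    have h1 : Setoid.ker f ≤ Setoid.comap (fun m => Sum.inr (Sum.inl m)) G := fun a b hab =>
      le_comap_lower r r (show r (Sum.inl a) (Sum.inl b) from hab)
    have h2 : Setoid.ker g ≤ Setoid.comap (fun m => Sum.inr (Sum.inl m)) G := fun a b hab =>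
      le_comap_upper r r (show r (Sum.inr a) (Sum.inr b) from hab)
    obtain ⟨m, hm⟩ : f x ∈ Set.range g := h ▸ Set.mem_range_self x
    obtain ⟨k, hk⟩ : g y ∈ Set.range f := h ▸ Set.mem_range_self y
    have e1 : G (Sum.inl x) (Sum.inr (Sum.inl m)) :=
      le_comap_upper r r (show r (Sum.inl x) (Sum.inr m) from hm.symm)
    have e2 : G (Sum.inr (Sum.inl k)) (Sum.inr (Sum.inr y)) :=
      le_comap_lower r r (show r (Sum.inl k) (Sum.inr y) from hk)
    have hmk : R m k := R.trans' (R.symm' (hfgR hm.symm)) (R.trans' hxy (R.symm' (hfgR hk)))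
    exact G.trans' e1 (G.trans' (sup_le h1 h2 hmk) e2)

/-- The two idempotents are `a * b` and `b * a` for `a = ofMaps f g` and `b = ofMaps g f`, whose
squares coincide. -/
theorem IsSplitting.idem_ker_mem_iff {A : Set (PIStar X)} (hA : IsSplitting A)
    {f g : Option X → Option X} (h : Set.range f = Set.range g) (h0 : f none = g none)
    (hf : ∀ x, (Setoid.ker f ⊔ Setoid.ker g) (f x) x)
    (hg : ∀ x, (Setoid.ker f ⊔ Setoid.ker g) (g x) x) :
    idem (Setoid.ker f) ∈ A ↔ idem (Setoid.ker g) ∈ A := by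
  rw [idem_ker, idem_ker, ← ofMaps_mul_ofMaps h h0 h.symm h0.symm,
    ← ofMaps_mul_ofMaps h.symm h0.symm h h0]
  apply hA.mul_comm_mem_iff
  rw [ofMaps_mul_self h h0 hf hg,
    ofMaps_mul_self h.symm h0.symm (by rwa [sup_comm]) (by rwa [sup_comm]), sup_comm]

/-! ### Atoms of the lattice of equivalence relations -/

section Atoms

variable [DecidableEq X]

/-- The equivalence relation whose only nontrivial class is `{u, v}`. -/
def atom (u v : Option X) : Setoid (Option X) := Setoid.ker (Function.update id u v)

theorem range_update_id {Y : Type*} [DecidableEq Y] {u v : Y} (h : u ≠ v) :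
    Set.range (Function.update id u v) = {u}ᶜ := by
  ext y
  constructor
  · rintro ⟨x, rfl⟩ hx
    by_cases hxu : x = u
    · subst hxu
      simp at hx
      exact h hx.symm
    · rw [Function.update_of_ne hxu] at hx
      exact hxu hx
  · exact fun hy => ⟨y, Function.update_of_ne hy _ _⟩

theorem ker_update_id_le_iff {Y : Type*} [DecidableEq Y] {u v : Y} {E : Setoid Y} :
    Setoid.ker (Function.update id u v) ≤ E ↔ E u v := by
  constructor
  · intro h
    refine h (?_ : Function.update id u v u = Function.update id u v v)
    by_cases huv : v = u
    · rw [huv]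
    · simp [Function.update_of_ne huv]
  · intro h x y hxy
    have key : ∀ x, E x (Function.update id u v x) := by
      intro x
      by_cases hx : x = u
      · subst hx
        simpa using h
      · rw [Function.update_of_ne hx]
        exact E.refl' x
    have hxy : Function.update id u v x = Function.update id u v y := hxy
    exact E.trans' (key x) (hxy ▸ E.symm' (key y))

/-- Sending `v` to `u` and sending `v` to `x̄` are maps with the same range, the complement of `v`,
and both fix `x̄`. -/
theorem IsSplitting.atom_mem_iff_atom_none {A : Set (PIStar X)} (hA : IsSplitting A)
    {u v : X} (h : v ≠ u) :
    idem (atom (some v) (some u)) ∈ A ↔ idem (atom (some v) none) ∈ A := by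
  have h1 : atom (some v) (some u) (some v) (some u) := ker_update_id_le_iff.1 le_rfl
  have h2 : atom (some v) none (some v) none := ker_update_id_le_iff.1 le_rfl
  refine hA.idem_ker_mem_iff ?_ ?_ ?_ ?_
  · rw [range_update_id (by simpa using h), range_update_id (by simp)]
  · rw [Function.update_of_ne (by simp), Function.update_of_ne (by simp)]
  · intro x
    by_cases hx : x = some v
    · subst hx
      rw [Function.update_self]
      exact (le_sup_left : atom (some v) (some u) ≤ _) (Setoid.symm' _ h1)
    · rw [Function.update_of_ne hx]
      exact Setoid.refl' _ _
  · intro x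
    by_cases hx : x = some v
    · subst hx
      rw [Function.update_self]
      exact (le_sup_right : atom (some v) none ≤ _) (Setoid.symm' _ h2)
    · rw [Function.update_of_ne hx]
      exact Setoid.refl' _ _

theorem IsSplitting.atom_none_mem_iff {A : Set (PIStar X)} (hA : IsSplitting A)
    (u w : X) :
    idem (atom (some u) none) ∈ A ↔ idem (atom (some w) none) ∈ A := by
  by_cases huw : u = w
  · rw [huw]
  let σ : Equiv.Perm (Option X) := Equiv.swap (some u) (some w)
  let f : Option X → Option X := Function.update id (some u) none
  -- The collapse of `w` misses `w`, that of `u` misses `u`. Composing with the transposition aligns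
  -- the ranges and keeps the kernel.
  let g : Option X → Option X := σ ∘ Function.update id (some w) none
  have hker : atom (some w) none = Setoid.ker g := by
    ext x y
    exact (σ.injective.eq_iff (a := Function.update id (some w) none x)).symm
  have h1 : (Setoid.ker f ⊔ Setoid.ker g) (some u) none :=
    (le_sup_left : Setoid.ker f ≤ _) (ker_update_id_le_iff.1 le_rfl)
  have h2 : (Setoid.ker f ⊔ Setoid.ker g) (some w) none :=
    (le_sup_right : Setoid.ker g ≤ _) (hker ▸ ker_update_id_le_iff.1 le_rfl)
  have hσ : σ none = none := Equiv.swap_apply_of_ne_of_ne (by simp) (by simp)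
  have huw' : some u ≠ some w := by simpa using huw
  rw [hker]
  refine hA.idem_ker_mem_iff (f := f) (g := g) ?_ ?_ ?_ ?_
  · rw [Set.range_comp, range_update_id (by simp), range_update_id (by simp),
      Set.image_compl_eq σ.bijective, Set.image_singleton, Equiv.swap_apply_right]
  · simp [f, g, hσ]
  · intro x
    by_cases hx : x = some u
    · subst hx
      simp only [f, Function.update_self]
      exact Setoid.symm' _ h1
    · simp only [f, Function.update_of_ne hx]
      exact Setoid.refl' _ _
  · intro x
    by_cases hx : x = some w
    · subst hx
      simp only [g, Function.comp_apply, Function.update_self, hσ]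
      exact Setoid.symm' _ h2
    · simp only [g, Function.comp_apply, Function.update_of_ne hx, id]
      -- Apart from `w`, only `u` is moved by `g`. It goes to `w`, and the join relates both to
      -- `none`.
      by_cases hxu : x = some u
      · subst hxu
        rw [Equiv.swap_apply_left]
        exact Setoid.trans' _ h2 (Setoid.symm' _ h1)
      · rw [Equiv.swap_apply_of_ne_of_ne hxu hx]

/-- `E` is the finite join of the atoms below it, so `idem E` is a product of atomic idempotents,
all on the side of the given one. -/
theorem IsSplitting.idem_mem [Finite X] {A : Set (PIStar X)} (hA : IsSplitting A)
    {u : X} (hu : idem (atom (some u) none) ∈ A) {E : Setoid (Option X)} (hE : E ≠ ⊥) :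
    idem E ∈ A := by
  classical
  have := Fintype.ofFinite X
  have hatom : ∀ (x : X) (y : Option X), some x ≠ y → idem (atom (some x) y) ∈ A := by
    rintro x (_ | y) hxy
    · exact (hA.atom_none_mem_iff u x).1 hu
    · exact (hA.atom_mem_iff_atom_none (by rintro rfl; exact hxy rfl)).2
        ((hA.atom_none_mem_iff u x).1 hu)
  -- Two distinct vertices of `X ∪ {x̄}` include one from `X`, so these pairs give every atom.
  let s : Finset (X × Option X) :=
    Finset.univ.filter fun p => E (some p.1) p.2 ∧ some p.1 ≠ p.2
  have hs : s.sup (fun p => atom (some p.1) p.2) = E := by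
    apply le_antisymm
    · refine Finset.sup_le fun p hp => ker_update_id_le_iff.2 ?_
      exact (Finset.mem_filter.1 hp).2.1
    · have key : ∀ (x : X) (y : Option X), E (some x) y →
          (s.sup fun p => atom (some p.1) p.2) (some x) y := by
        intro x y hxy
        by_cases hne : some x = y
        · rw [hne]
        · exact ker_update_id_le_iff.1 (Finset.le_sup (f := fun p : X × Option X =>
            atom (some p.1) p.2) (Finset.mem_filter.2 ⟨Finset.mem_univ (x, y), hxy, hne⟩))
      rintro (_ | x) (_ | y) hxy
      · exact Setoid.refl' _ _
      · exact Setoid.symm' _ (key _ _ (E.symm' hxy))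
      · exact key _ _ hxy
      · exact key _ _ hxy
  have hind : s.sup (fun p => atom (some p.1) p.2) = ⊥ ∨
      idem (s.sup fun p => atom (some p.1) p.2) ∈ A := by
    -- The alternative `F = ⊥` covers the empty join, since `idem ⊥` need not lie in `A`.
    refine Finset.sup_induction (p := fun F => F = ⊥ ∨ idem F ∈ A) (Or.inl rfl) ?_ ?_
    · rintro F (rfl | hF) G (rfl | hG)
      · simp
      · simpa using Or.inr hG
      · simpa using Or.inr hF
      · exact Or.inr (idem_mul_idem F G ▸ hA.mul_mem _ hF _ hG)
    · exact fun p hp => Or.inr (hatom p.1 p.2 (Finset.mem_filter.1 hp).2.2)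
  rw [hs] at hind
  exact hind.resolve_left hE

/-- Nonunits outside `A` would form a subsemigroup, whose idempotent is some `idem E` with `E ≠ ⊥`
and hence in `A`. -/
theorem IsSplitting.compl_symmetricGroup_subset [Finite X] {A : Set (PIStar X)}
    (hA : IsSplitting A) {u : X} (hu : idem (atom (some u) none) ∈ A) :
    (symmetricGroup X)ᶜ ⊆ A := by
  by_contra hn
  obtain ⟨a, ha, haA⟩ := Set.not_subset.1 hn
  obtain ⟨E, hE, hEA⟩ := exists_idem_mem (A := (symmetricGroup X)ᶜ ∩ Aᶜ) ⟨a, ha, haA⟩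
    fun x hx y hy => ⟨fun h => hx.1 (left_mem_symmetricGroup_of_mul h),
      hA.mul_notMem x hx.2 y hy.2⟩
  exact hEA (hA.idem_mem hu fun h => hE (idem_mem_symmetricGroup_iff.2 h))

end Atoms

/-! ### Classification of the splittings -/

theorem isSplitting_symmetricGroup [Finite X] : IsSplitting (symmetricGroup X) :=
  ⟨fun _ ha _ hb => mul_mem_symmetricGroup ha hb,
    fun _ ha _ _ h => ha (left_mem_symmetricGroup_of_mul h)⟩

theorem IsSplitting.eq_of_nonempty [Finite X] [Nonempty X] {A : Set (PIStar X)}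
    (hA : IsSplitting A) (hne : A.Nonempty) :
    A = Set.univ ∨ A = symmetricGroup X ∨ A = (symmetricGroup X)ᶜ := by
  classical
  obtain ⟨u⟩ := ‹Nonempty X›
  -- The identity decides the side of all units, the atom that of all nonunits; negative cases use
  -- the complementary splitting.
  by_cases h1 : idem ⊥ ∈ A <;> by_cases h2 : idem (atom (some u) none) ∈ A
  · left
    have := Set.union_subset (symmetricGroup_subset_of_idem_bot_mem hA h1)
      (hA.compl_symmetricGroup_subset h2)
    rwa [Set.union_compl_self, Set.univ_subset_iff] at this
  · right; left
    exact (Set.compl_subset_compl.1 (hA.compl.compl_symmetricGroup_subset h2)).antisymm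
      (symmetricGroup_subset_of_idem_bot_mem hA h1)
  · right; right
    exact (Set.subset_compl_comm.1 (symmetricGroup_subset_of_idem_bot_mem hA.compl h1)).antisymm
      (hA.compl_symmetricGroup_subset h2)
  · have := Set.union_subset (symmetricGroup_subset_of_idem_bot_mem hA.compl h1)
      (hA.compl.compl_symmetricGroup_subset h2)
    rw [Set.union_compl_self, Set.univ_subset_iff, Set.compl_univ_iff] at this
    exact absurd this hne.ne_empty

theorem compl_symmetricGroup_nonempty [Finite X] [Nonempty X] :
    (symmetricGroup X)ᶜ.Nonempty := by
  obtain ⟨u⟩ := ‹Nonempty X›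
  refine ⟨idem ⊤, fun h => Option.some_ne_none u ?_⟩
  have : (⊤ : Setoid (Option X)) (some u) none := trivial
  rwa [idem_mem_symmetricGroup_iff.1 h] at this

theorem exists_isCompletelyIsolated_iff {S : Type*} [Semigroup S] {A : Set S} :
    (∃ T : Subsemigroup S, (T : Set S) = A ∧ IsCompletelyIsolated T) ↔
      A.Nonempty ∧ IsSplitting A := by
  constructor
  · rintro ⟨T, rfl, hne, hT⟩
    exact ⟨hne, fun a ha b hb => T.mul_mem ha hb,
      fun a ha b hb hab => (hT a b hab).elim ha hb⟩
  · rintro ⟨hne, hA⟩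
    refine ⟨⟨A, fun ha hb => hA.mul_mem _ ha _ hb⟩, rfl, hne, fun a b hab => ?_⟩
    by_contra! hn
    exact hA.mul_notMem a hn.1 b hn.2 hab

end PIStar

theorem mainTheorem7 (n : ℕ) (hn : 2 ≤ n) :
    {A : Set (PIStar (Fin n)) |
        ∃ T : Subsemigroup (PIStar (Fin n)), (T : Set (PIStar (Fin n))) = A ∧
          IsCompletelyIsolated T} =
      {Set.univ, PIStar.symmetricGroup (Fin n), (PIStar.symmetricGroup (Fin n))ᶜ} := by
  have : Nonempty (Fin n) := ⟨⟨0, by omega⟩⟩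
  ext A
  rw [Set.mem_ofPred_eq, PIStar.exists_isCompletelyIsolated_iff]
  constructor
  · exact fun h => h.2.eq_of_nonempty h.1
  · rintro (rfl | rfl | rfl)
    · exact ⟨⟨PIStar.ofPerm 1, trivial⟩, fun _ _ _ _ => trivial, fun a ha => absurd trivial ha⟩
    · exact ⟨⟨PIStar.ofPerm 1, 1, rfl⟩, PIStar.isSplitting_symmetricGroup⟩
    · exact ⟨PIStar.compl_symmetricGroup_nonempty, PIStar.isSplitting_symmetricGroup.compl⟩
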